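/- Let $R$ be an associative unital ring, $M$ a right $R$-module and $\mathfrak S=\mathrm{End}(M_R)$ its endomorphism ring, endowed with the finite topology: a base of neighbourhoods of zero is formed by the annihilators of the finitely generated $R$-submodules of $M$. This is a complete, separated topological ring in which the open left ideals form a base of neighbourhoods of zero, and $M$ is a discrete left $\mathfrak S$-module, i.e. the annihilator in $\mathfrak S$ of every element of $M$ is open. For a set $X$, let $[[X]]\mathfrak S$ be the group of all formal linear combinations $\sum_{x\in X}xs_x$ with $s_x\in\mathfrak S$ such that for every open left ideal $\mathfrak I$ one has $s_x\in\mathfrak I$ for all but finitely many $x$. The functor $X\mapsto[[X]]\mathfrak S$ is a monad on the category of sets, with the point measures $x\mapsto 1\cdot x$ as unit and the opening of parentheses as multiplication, infinite sums of coefficients being limits of finite partial sums in $\mathfrak S$. A right $\mathfrak S$-contramodule is a module (algebra) $\pi_{\mathfrak C}\colon[[\mathfrak C]]\mathfrak S\to\mathfrak C$ over this monad; such a $\mathfrak C$ is in particular an abelian group. For a right $\mathfrak S$-contramodule $\mathfrak C$, the contratensor product $\mathfrak C\odot_{\mathfrak S}M$ is the cokernel of the difference of the two maps $[[\mathfrak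 C]]\mathfrak S\otimes_{\mathbb Z}M\rightrightarrows\mathfrak C\otimes_{\mathbb Z}M$ given by $\left(\sum_c cs_c\right)\otimes b\mapsto\sum_c c\otimes s_cb$ and by $\pi_{\mathfrak C}\otimes\mathrm{id}_M$; it is a right $R$-module through the action of $R$ on $M$. Let $\mathrm{Add}\,M$ be the class of all direct summands of direct sums of copies of $M$. For a class $\mathsf C$ of objects of a category $\mathsf B$, let $\varinjlim^{\mathsf B}\mathsf C$ be the class of all objects of $\mathsf B$ that are direct limits, computed in $\mathsf B$, of direct systems of objects from $\mathsf C$ indexed by (nonempty) directed posets; write $\varinjlim$ when $\mathsf B$ is the category of right $R$-modules. **Theorem.** A right $R$-module $N$ belongs to $\varinjlim\mathrm{Add}\,M$ if and only if $N\cong\mathfrak F\odot_{\mathfrak S}M$ for some right $\mathfrak S$-contramodule $\mathfrak F$ which is a direct limit, computed in the category of right $\mathfrak S$-contramodules, of a direct system of projective objects of that category. -/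

import Mathlib

open CategoryTheory TensorProduct Topology

set_option linter.unusedSectionVars false

universe u v

namespace Contramodules

/-! ### Zero-convergent families over a complete, separated, left linear topological ring -/

section ZeroConvergent

variable (S : Type v) [Ring S] [UniformSpace S]

/-- The group `[[X]]S` of formal linear combinations `∑ x s_x` of elements of `X`, that is, of
families of coefficients in `S` which converge to zero: for every open left ideal `I` of `S`,
all but finitely many of the coefficients belong to `I`. -/
def ZeroConv (X : Type v) : AddSubgroup (X → S) where
  carrier := {s | ∀ I : Ideal S, IsOpen (I : Set S) → {x | s x ∉ I}.Finite}
  zero_mem' := fun I _ => by simp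
  add_mem' := by
    intro s t hs ht I hI
    refine ((hs I hI).union (ht I hI)).subset fun x hx => ?_
    by_contra h
    simp only [Set.mem_union, Set.mem_ofPred_eq, not_or, not_not] at h
    exact hx (I.add_mem h.1 h.2)
  neg_mem' := by
    intro s hs I hI
    simpa using hs I hI

variable {S}

/-- The point measure `1 · x`. -/
noncomputable def point {X : Type v} (x : X) : ZeroConv S X := by
  classical
  exact ⟨Pi.single x 1, fun I _ => (Set.finite_singleton x).subset fun y hy => by
    by_contra h
    exact hy (by simp [Pi.single_eq_of_ne h])⟩

theorem point_apply {X : Type v} [DecidableEq X] (x y : X) :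
    (point x : ZeroConv S X).1 y = if y = x then 1 else 0 := by
  simp only [point, Pi.single_apply]
  congr

variable [IsUniformAddGroup S] [IsTopologicalRing S] [IsLinearTopology S S]

theorem nonarchimedeanAddGroup : NonarchimedeanAddGroup S where
  is_nonarchimedean := fun U hU => by
    obtain ⟨I, hI, hIU⟩ := (IsLinearTopology.hasBasis_open_submodule S (M := S)).mem_iff.1 hU
    exact ⟨⟨I.toAddSubgroup, hI⟩, hIU⟩

theorem tendsto_zero_of_finite {Y : Type*} {f : Y → S}
    (h : ∀ I : Ideal S, IsOpen (I : Set S) → {y | f y ∉ I}.Finite) :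
    Filter.Tendsto f Filter.cofinite (𝓝 0) := by
  rw [(IsLinearTopology.hasBasis_open_submodule S (M := S)).tendsto_right_iff]
  intro I hI
  exact h I hI

/-- Continuity of right multiplication makes `k_{x,y} s_x` zero-convergent on `X × Y`. -/
theorem finite_pairs {X Y : Type v} (k : X → ZeroConv S Y) (s : ZeroConv S X)
    (I : Ideal S) (hI : IsOpen (I : Set S)) :
    {p : X × Y | (k p.1).1 p.2 * s.1 p.1 ∉ I}.Finite := by
  have key : ∀ x, {y | (k x).1 y * s.1 x ∉ I}.Finite := by
    intro x
    let J : Ideal S := Submodule.comap (LinearMap.toSpanSingleton S S (s.1 x)) I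
    have hJ : IsOpen (J : Set S) := hI.preimage (continuous_id.mul continuous_const)
    exact (k x).2 J hJ
  refine ((s.2 I hI).biUnion fun x _ => (Set.finite_singleton x).prod (key x)).subset ?_
  rintro ⟨x, y⟩ h
  simp only [Set.mem_iUnion, Set.mem_prod, Set.mem_singleton_iff, Set.mem_ofPred_eq]
  exact ⟨x, fun hx => h (I.mul_mem_left _ hx), rfl, h⟩

variable [CompleteSpace S]

theorem summable_of_finite {Y : Type*} {f : Y → S}
    (h : ∀ I : Ideal S, IsOpen (I : Set S) → {y | f y ∉ I}.Finite) : Summable f :=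
  haveI := nonarchimedeanAddGroup (S := S)
  NonarchimedeanAddGroup.summable_of_tendsto_cofinite_zero (tendsto_zero_of_finite h)

theorem summable_fst {X Y : Type v} (k : X → ZeroConv S Y) (s : ZeroConv S X) (y : Y) :
    Summable fun x => (k x).1 y * s.1 x :=
  summable_of_finite fun I hI =>
    ((s.2 I hI).subset fun _ hx h => hx (I.mul_mem_left _ h))

/-- Substituting `∑_y y k_{x,y}` for `x` in `∑_x x s_x` gives `∑_y y (∑_x k_{x,y} s_x)`. -/
noncomputable def subst {X Y : Type v} (k : X → ZeroConv S Y) (s : ZeroConv S X) :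
    ZeroConv S Y :=
  ⟨fun y => ∑' x, (k x).1 y * s.1 x, fun I hI => by
    refine ((finite_pairs k s I hI).image Prod.snd).subset fun y hy => ?_
    by_contra h
    refine hy ?_
    refine tsum_mem (s := I.toAddSubgroup)
      (AddSubgroup.isClosed_of_isOpen I.toAddSubgroup hI) fun x => ?_
    by_contra hx
    exact h ⟨(x, y), hx, rfl⟩⟩

/-- The "opening of parentheses" map: `∑_t t s_t`, with each `t` itself a formal linear combination
`∑_x x t_x`, goes to `∑_x x (∑_t t_x s_t)`. -/
noncomputable def join {X : Type v} (s : ZeroConv S (ZeroConv S X)) : ZeroConv S X :=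
  subst id s

theorem join_apply {X : Type v} (s : ZeroConv S (ZeroConv S X)) (x : X) :
    (join s).1 x = ∑' t, t.1 x * s.1 t := rfl

theorem tsum_fiber {X Y : Type v} (f : X → Y) (s : X → S) (y : Y) :
    ∑' x : f ⁻¹' {y}, s x = ∑' x, (point (f x) : ZeroConv S Y).1 y * s x := by
  classical
  rw [tsum_subtype]
  refine tsum_congr fun x => ?_
  rw [point_apply, Set.indicator_apply]
  by_cases h : f x = y
  · simp [h]
  · simp [h, Ne.symm h]

/-- The map `[[X]]S → [[Y]]S` induced by a map `f : X → Y`: the coefficient at `y` is the sum of the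
coefficients over the fibre of `y`. -/
noncomputable def push {X Y : Type v} (f : X → Y) (s : ZeroConv S X) : ZeroConv S Y :=
  ⟨fun y => ∑' x : f ⁻¹' {y}, s.1 x, by
    have h : (fun y => ∑' x : f ⁻¹' {y}, s.1 x) = (subst (fun x => point (f x)) s).1 :=
      funext fun y => tsum_fiber f s.1 y
    rw [h]
    exact (subst (fun x => point (f x)) s).2⟩

theorem push_eq_subst {X Y : Type v} (f : X → Y) (s : ZeroConv S X) :
    push f s = subst (fun x => point (f x)) s :=
  Subtype.ext (funext fun y => tsum_fiber f s.1 y)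

variable [T2Space S]

theorem subst_add {X Y : Type v} (k : X → ZeroConv S Y) (s t : ZeroConv S X) :
    subst k (s + t) = subst k s + subst k t := by
  refine Subtype.ext (funext fun y => ?_)
  change ∑' x, (k x).1 y * (s.1 x + t.1 x) = _
  simp only [mul_add]
  exact (summable_fst k s y).tsum_add (summable_fst k t y)

theorem subst_point {X Y : Type v} (k : X → ZeroConv S Y) (x : X) :
    subst k (point x) = k x := by
  classical
  refine Subtype.ext (funext fun y => ?_)
  change ∑' x', (k x').1 y * (point x : ZeroConv S X).1 x' = _
  rw [tsum_eq_single x]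
  · simp [point_apply]
  · intro x' hx'
    simp [point_apply, hx']

theorem subst_self {X : Type v} (s : ZeroConv S X) : subst point s = s := by
  classical
  refine Subtype.ext (funext fun y => ?_)
  change ∑' x, (point x : ZeroConv S X).1 y * s.1 x = _
  rw [tsum_eq_single y]
  · simp [point_apply]
  · intro x' hx'
    simp [point_apply, hx'.symm]

theorem subst_subst {X Y Z : Type v} (l : Y → ZeroConv S Z) (k : X → ZeroConv S Y)
    (s : ZeroConv S X) : subst l (subst k s) = subst (fun x => subst l (k x)) s := by
  refine Subtype.ext (funext fun z => ?_)
  change ∑' y, (l y).1 z * (∑' x, (k x).1 y * s.1 x)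
    = ∑' x, (∑' y, (l y).1 z * (k x).1 y) * s.1 x
  have h1 : ∀ y, (l y).1 z * (∑' x, (k x).1 y * s.1 x)
      = ∑' x, (l y).1 z * ((k x).1 y * s.1 x) :=
    fun y => ((summable_fst k s y).tsum_mul_left _).symm
  have h2 : ∀ x, (∑' y, (l y).1 z * (k x).1 y) * s.1 x
      = ∑' y, (l y).1 z * ((k x).1 y * s.1 x) := by
    intro x
    rw [← (summable_fst l (k x) z).tsum_mul_right]
    simp only [mul_assoc]
  simp only [h1, h2]
  refine Summable.tsum_comm (f := fun x y => (l y).1 z * ((k x).1 y * s.1 x)) ?_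
  exact summable_of_finite fun I hI =>
    (finite_pairs k s I hI).subset fun p hp h => hp (I.mul_mem_left _ h)

theorem push_point {X Y : Type v} (f : X → Y) (x : X) :
    push f (point x : ZeroConv S X) = point (f x) := by
  rw [push_eq_subst, subst_point]

theorem join_point {X : Type v} (s : ZeroConv S X) : join (point s) = s :=
  subst_point id s

theorem join_push_point {X : Type v} (s : ZeroConv S X) : join (push point s) = s := by
  simp only [join, push_eq_subst, subst_subst, subst_point, id, subst_self]

theorem push_add {X Y : Type v} (f : X → Y) (s t : ZeroConv S X) :
    push f (s + t) = push f s + push f t := by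
  simp only [push_eq_subst, subst_add]

theorem join_add {X : Type v} (s t : ZeroConv S (ZeroConv S X)) :
    join (s + t) = join s + join t :=
  subst_add id s t

variable (S)

/-- The monad `X ↦ [[X]]S` on the category of sets. -/
noncomputable def contraMonad : Monad (Type v) where
  obj X := ZeroConv S X
  map f := TypeCat.ofHom (push f)
  map_id X := by
    refine ConcreteCategory.hom_ext _ _ fun s => ?_
    exact (push_eq_subst _ _).trans (subst_self s)
  map_comp f g := by
    refine ConcreteCategory.hom_ext _ _ fun s => ?_
    change push (g ∘ f) s = push g (push f s)
    simp only [push_eq_subst, subst_subst, subst_point, Function.comp]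
  η := 
    { app := fun X => TypeCat.ofHom point
      naturality := fun X Y f => by
        refine ConcreteCategory.hom_ext _ _ fun x => ?_
        exact (push_point f x).symm }
  μ := 
    { app := fun X => TypeCat.ofHom join
      naturality := fun X Y f => by
        refine ConcreteCategory.hom_ext _ _ fun s => ?_
        change join (push (push f) s) = push f (join s)
        simp only [join, push_eq_subst, subst_subst, subst_point, id] }
  assoc X := by
    refine ConcreteCategory.hom_ext _ _ fun s => ?_
    change join (push join s) = join (join s)
    simp only [join, push_eq_subst, subst_subst, subst_point, id]
  left_unit X := by
    refine ConcreteCategory.hom_ext _ _ fun s => ?_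
    exact join_point s
  right_unit X := by
    refine ConcreteCategory.hom_ext _ _ fun s => ?_
    exact join_push_point s

/-- The category of right `S`-contramodules: modules (algebras) over the monad `X ↦ [[X]]S`. -/
abbrev Contra := (contraMonad S).Algebra

end ZeroConvergent

/-! ### The abelian group underlying a contramodule -/

section ContraGroup

variable {S : Type v} [Ring S] [UniformSpace S] [IsUniformAddGroup S] [IsTopologicalRing S]
  [IsLinearTopology S S] [CompleteSpace S] [T2Space S] (C : Contra S)

/-- The contraaction map `[[C]]S → C`. -/
def act : ZeroConv S C.A → C.A := C.a

theorem act_point (c : C.A) : act C (point c) = c :=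
  ConcreteCategory.congr_hom C.unit c

theorem act_join (s : ZeroConv S (ZeroConv S C.A)) :
    act C (join s) = act C (push (act C) s) :=
  ConcreteCategory.congr_hom C.assoc s

/-- The sum in a contramodule is the value of the contraaction on `1 · a + 1 · b`; the other
operations are defined in the same way. -/
noncomputable instance : Add C.A := ⟨fun a b => act C (point a + point b)⟩
noncomputable instance : Zero C.A := ⟨act C 0⟩
noncomputable instance : Neg C.A := ⟨fun a => act C (-point a)⟩
noncomputable instance : Sub C.A := ⟨fun a b => act C (point a - point b)⟩
noncomputable instance : SMul ℕ C.A := ⟨fun n a => act C (n • point a)⟩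
noncomputable instance : SMul ℤ C.A := ⟨fun n a => act C (n • point a)⟩

/-- `push` as a homomorphism. -/
noncomputable def pushHom {X Y : Type v} (f : X → Y) : ZeroConv S X →+ ZeroConv S Y :=
  AddMonoidHom.mk' (push f) (push_add f)

/-- `join` as a homomorphism. -/
noncomputable def joinHom (X : Type v) : ZeroConv S (ZeroConv S X) →+ ZeroConv S X :=
  AddMonoidHom.mk' join join_add

theorem act_pushHom (s : ZeroConv S (ZeroConv S C.A)) :
    act C (pushHom (act C) s) = act C (joinHom C.A s) := (act_join C s).symm

theorem pushHom_point {X Y : Type v} (f : X → Y) (x : X) :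
    pushHom f (point x : ZeroConv S X) = point (f x) := push_point f x

theorem joinHom_point {X : Type v} (s : ZeroConv S X) : joinHom X (point s) = s := join_point s

theorem act_add (s t : ZeroConv S C.A) : act C (s + t) = act C s + act C t := by
  have h := act_pushHom C (point s + point t)
  simp only [map_add, pushHom_point, joinHom_point] at h
  exact h.symm

noncomputable instance : AddCommGroup C.A :=
  Function.Surjective.addCommGroup (act C) (fun c => ⟨point c, act_point C c⟩) rfl (act_add C)
    (fun s => by
      have h := act_pushHom C (-point s)
      simp only [map_neg, pushHom_point, joinHom_point] at h
      exact h.symm)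
    (fun s t => by
      have h := act_pushHom C (point s - point t)
      simp only [map_sub, pushHom_point, joinHom_point] at h
      exact h.symm)
    (fun s n => by
      have h := act_pushHom C (n • point s)
      simp only [map_nsmul, pushHom_point, joinHom_point] at h
      exact h.symm)
    (fun s n => by
      have h := act_pushHom C (n • point s)
      simp only [map_zsmul, pushHom_point, joinHom_point] at h
      exact h.symm)

/-- The contraaction as a homomorphism of abelian groups. -/
noncomputable def actHom : ZeroConv S C.A →+ C.A := AddMonoidHom.mk' (act C) (act_add C)

end ContraGroup

/-! ### Discrete modules and the contratensor product -/

/-- A left `S`-module `M` is discrete if the annihilator of every element is open. -/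
class IsDiscreteModule (S M : Type*) [Ring S] [TopologicalSpace S] [AddCommGroup M]
    [Module S M] : Prop where
  isOpen_annihilator : ∀ b : M, IsOpen {s : S | s • b = 0}

section Contratensor

variable {S : Type v} [Ring S] [UniformSpace S]

theorem finite_support {M : Type v} [AddCommGroup M] [Module S M] [IsDiscreteModule S M]
    {X : Type v} (s : ZeroConv S X) (b : M) : {x | s.1 x • b ≠ 0}.Finite := by
  have h := s.2 (LinearMap.ker (LinearMap.toSpanSingleton S M b))
    (IsDiscreteModule.isOpen_annihilator b)
  simpa using h

variable [IsUniformAddGroup S] [IsTopologicalRing S] [IsLinearTopology S S] [CompleteSpace S]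
  [T2Space S] (A : Type u) [Ring A] (C : Contra S) (M : Type v) [AddCommGroup M] [Module A M]
  [Module S M] [SMulCommClass S A M] [IsDiscreteModule S M]

theorem finite_support_tmul (s : ZeroConv S C.A) (b : M) :
    (Function.support fun c : C.A => (s.1 c • b) ⊗ₜ[ℤ] c).Finite :=
  (finite_support s b).subset fun c hc h => hc (by simp [h])

/-- The map `t : [[C]]S ⊗ M → C ⊗ M` given by `(∑ c s_c) ⊗ b ↦ ∑ c ⊗ s_c b`, a finite sum.
The factors of the tensor products over `ℤ` are written in the opposite order, so that they carry
the action of `A` through `M` as an instance. -/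
noncomputable def tMap : M ⊗[ℤ] ZeroConv S C.A →ₗ[A] M ⊗[ℤ] C.A :=
  TensorProduct.AlgebraTensorModule.lift
    { toFun := fun b => AddMonoidHom.toIntLinearMap
        (AddMonoidHom.mk' (fun s : ZeroConv S C.A => ∑ᶠ c, (s.1 c • b) ⊗ₜ[ℤ] c) (by
          intro s t
          rw [← finsum_add_distrib (finite_support_tmul C M s b) (finite_support_tmul C M t b)]
          refine finsum_congr fun c => ?_
          rw [← TensorProduct.add_tmul, ← add_smul]
          rfl))
      map_add' := by
        intro b b'
        ext s
        change ∑ᶠ c, (s.1 c • (b + b')) ⊗ₜ[ℤ] c = _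
        simp only [smul_add, TensorProduct.add_tmul]
        exact finsum_add_distrib (finite_support_tmul C M s b) (finite_support_tmul C M s b')
      map_smul' := by
        intro a b
        ext s
        change ∑ᶠ c, (s.1 c • (a • b)) ⊗ₜ[ℤ] c = a • ∑ᶠ c, (s.1 c • b) ⊗ₜ[ℤ] c
        rw [smul_finsum' _ (finite_support_tmul C M s b)]
        refine finsum_congr fun c => ?_
        rw [smul_comm, TensorProduct.smul_tmul'] }

theorem tMap_tmul (b : M) (s : ZeroConv S C.A) :
    tMap A C M (b ⊗ₜ[ℤ] s) = ∑ᶠ c, (s.1 c • b) ⊗ₜ[ℤ] c := rfl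

/-- The map `π_C ⊗ M : [[C]]S ⊗ M → C ⊗ M`. -/
noncomputable def actMap : M ⊗[ℤ] ZeroConv S C.A →ₗ[A] M ⊗[ℤ] C.A :=
  TensorProduct.AlgebraTensorModule.map LinearMap.id (actHom C).toIntLinearMap

/-- The contratensor product `C ⊙_S M`: the cokernel of the difference of the two maps
`[[C]]S ⊗ M ⇉ C ⊗ M`. Any ring `A` acting on `M` by `S`-linear maps acts on it. -/
abbrev Contratensor : Type v :=
  (M ⊗[ℤ] C.A) ⧸ LinearMap.range (tMap A C M - actMap A C M)

end Contratensor

/-! ### The finite topology on an endomorphism ring -/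

section FiniteTopology

variable {A : Type u} [Ring A] {M : Type v} [AddCommGroup M] [Module A M]

/-- The endomorphisms annihilating a submodule. -/
def endAnnihilator (N : Submodule A M) : AddSubgroup (Module.End A M) where
  carrier := {f | ∀ m ∈ N, f m = 0}
  zero_mem' := fun _ _ => rfl
  add_mem' := fun hf hg m hm => by simp [hf m hm, hg m hm]
  neg_mem' := fun hf m hm => by simp [hf m hm]

theorem endAnnihilator_basis :
    RingSubgroupsBasis fun N : {N : Submodule A M // N.FG} => endAnnihilator N.1 where
  inter := fun N N' => ⟨⟨N.1 ⊔ N'.1, N.2.sup N'.2⟩, fun _ hf =>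
    ⟨fun m hm => hf m (Submodule.mem_sup_left hm), fun m hm => hf m (Submodule.mem_sup_right hm)⟩⟩
  mul := fun N => ⟨N, by
    rintro _ ⟨f, _, g, hg, rfl⟩ m hm
    simp [hg m hm]⟩
  leftMul := fun f N => ⟨N, fun g hg m hm => by simp [hg m hm]⟩
  rightMul := fun f N => ⟨⟨N.1.map f, N.2.map f⟩, fun g hg m hm =>
    hg (f m) (Submodule.mem_map_of_mem hm)⟩

instance : Nonempty {N : Submodule A M // N.FG} := ⟨⟨⊥, Submodule.fg_bot⟩⟩

/-- The finite topology on `End_A(M)`: the annihilators of finitely generated submodules of `M`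
form a base of neighbourhoods of zero. -/
abbrev finiteTopology (A : Type u) [Ring A] (M : Type v) [AddCommGroup M] [Module A M] :
    TopologicalSpace (Module.End A M) :=
  (endAnnihilator_basis (A := A) (M := M)).topology

theorem finiteTopology_isTopologicalRing :
    @IsTopologicalRing _ (finiteTopology A M) _ :=
  letI := finiteTopology A M
  haveI := (endAnnihilator_basis (A := A) (M := M)).nonarchimedean
  inferInstance

/-- `End_A(M)` as a uniform space, with the uniformity of the finite topology. -/
noncomputable instance : UniformSpace (Module.End A M) :=
  letI := finiteTopology A M
  haveI := finiteTopology_isTopologicalRing (A := A) (M := M)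
  IsTopologicalAddGroup.rightUniformSpace (Module.End A M)

instance : IsTopologicalRing (Module.End A M) := finiteTopology_isTopologicalRing

instance : IsUniformAddGroup (Module.End A M) :=
  letI := finiteTopology A M
  isUniformAddGroup_of_addCommGroup

theorem hasBasis_nhds_zero : (𝓝 (0 : Module.End A M)).HasBasis (fun _ => True)
    fun N : {N : Submodule A M // N.FG} => (endAnnihilator N.1 : Set (Module.End A M)) :=
  (endAnnihilator_basis (A := A) (M := M)).hasBasis_nhds_zero

instance : IsLinearTopology (Module.End A M) (Module.End A M) where
  hasBasis_submodule' := hasBasis_nhds_zero.to_hasBasis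
    (fun N _ => ⟨{ endAnnihilator N.1 with
        smul_mem' := fun f g hg m hm => by
          have h : g m = 0 := hg m hm
          simp [h] },
      hasBasis_nhds_zero.mem_of_mem trivial, subset_rfl⟩)
    (fun _ h => hasBasis_nhds_zero.mem_iff.1 h)

theorem isOpen_endAnnihilator {N : Submodule A M} (hN : N.FG) :
    IsOpen (endAnnihilator N : Set (Module.End A M)) :=
  AddSubgroup.isOpen_of_mem_nhds (endAnnihilator N) (g := 0)
    (hasBasis_nhds_zero.mem_of_mem (i := ⟨N, hN⟩) trivial)

theorem fg_span_singleton (m : M) : (Submodule.span A {m}).FG := ⟨{m}, by simp⟩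

theorem isOpen_annihilator_singleton (m : M) : IsOpen {f : Module.End A M | f m = 0} := by
  convert isOpen_endAnnihilator (fg_span_singleton (A := A) m) using 1
  ext f
  refine ⟨fun h x hx => ?_, fun h => h m (Submodule.mem_span_singleton_self m)⟩
  obtain ⟨a, rfl⟩ := Submodule.mem_span_singleton.1 hx
  have h' : f m = 0 := h
  simp [h']

instance : T2Space (Module.End A M) := by
  have : T1Space (Module.End A M) := by
    refine IsTopologicalAddGroup.t1Space _ ?_
    have h : ({0} : Set (Module.End A M)) = ⋂ m : M, {f | f m = 0} := by
      ext f
      simp [LinearMap.ext_iff]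
    rw [h]
    refine isClosed_iInter fun m => ?_
    have hm := isOpen_annihilator_singleton (A := A) m
    exact AddSubgroup.isClosed_of_isOpen
      (AddMonoidHom.ker (LinearMap.toAddMonoidHom (LinearMap.applyₗ' ℤ m : Module.End A M →ₗ[ℤ] M)))
      (by convert hm using 1; ext f; exact Iff.rfl)
  infer_instance

instance : CompleteSpace (Module.End A M) where
  complete := by
    intro F hF
    have hF' := cauchy_iff.1 hF
    have := hF.1
    have key : ∀ N : Submodule A M, N.FG → ∃ t ∈ F, ∀ f ∈ t, ∀ g ∈ t, ∀ m ∈ N, f m = g m := by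
      intro N hN
      have hU : {p : Module.End A M × Module.End A M | p.2 - p.1 ∈ endAnnihilator N} ∈
          uniformity (Module.End A M) := by
        rw [uniformity_eq_comap_nhds_zero]
        exact Filter.preimage_mem_comap (hasBasis_nhds_zero.mem_of_mem (i := ⟨N, hN⟩) trivial)
      obtain ⟨t, ht, htU⟩ := hF'.2 _ hU
      refine ⟨t, ht, fun f hf g hg m hm => ?_⟩
      have h := htU (Set.mk_mem_prod hg hf) m hm
      exact sub_eq_zero.1 h
    have ex : ∀ m : M, ∃ y : M, {f : Module.End A M | f m = y} ∈ F := by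
      intro m
      obtain ⟨t, ht, h⟩ := key _ (fg_span_singleton m)
      obtain ⟨g, hg⟩ := Filter.nonempty_of_mem ht
      exact ⟨g m, Filter.mem_of_superset ht fun f hf =>
        h f hf g hg m (Submodule.mem_span_singleton_self m)⟩
    choose y hy using ex
    let φ : Module.End A M :=
      { toFun := y
        map_add' := by
          intro m n
          obtain ⟨f, ⟨h1, h2⟩, h3⟩ := Filter.nonempty_of_mem
            (Filter.inter_mem (Filter.inter_mem (hy m) (hy n)) (hy (m + n)))
          change f m = y m at h1
          change f n = y n at h2
          change f (m + n) = y (m + n) at h3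
          rw [← h1, ← h2, ← h3, map_add]
        map_smul' := by
          intro a m
          obtain ⟨f, h1, h2⟩ := Filter.nonempty_of_mem (Filter.inter_mem (hy m) (hy (a • m)))
          change f m = y m at h1
          change f (a • m) = y (a • m) at h2
          rw [← h1, ← h2, map_smul]
          rfl }
    refine ⟨φ, ?_⟩
    have hb : (𝓝 φ).HasBasis (fun _ => True) fun N : {N : Submodule A M // N.FG} =>
        {f | f - φ ∈ endAnnihilator N.1} := by
      have := (hasBasis_nhds_zero (A := A) (M := M)).comap fun f => f - φ
      rwa [nhds_translation_sub] at this
    rw [hb.ge_iff]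
    intro N _
    obtain ⟨t, ht, h⟩ := key N.1 N.2
    refine Filter.mem_of_superset ht fun f hf m hm => ?_
    obtain ⟨g, hg, hgm⟩ := Filter.nonempty_of_mem (Filter.inter_mem ht (hy m))
    have h2 : g m = φ m := hgm
    rw [LinearMap.sub_apply, h f hf g hg m hm, h2, sub_self]

instance : IsDiscreteModule (Module.End A M) M where
  isOpen_annihilator m := isOpen_annihilator_singleton m

end FiniteTopology

/-! ### The class `Add M` and classes of direct limits -/

/-- `Add M`: the class of all direct summands of direct sums of copies of `M`. -/
def AddClosure (A : Type u) [Ring A] (M : Type v) [AddCommGroup M] [Module A M] :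
    ObjectProperty (ModuleCat.{v} A) :=
  fun D => ∃ (X : Type v) (E : ModuleCat.{v} A), Nonempty ((D × E) ≃ₗ[A] (X →₀ M))

/-- The class of all objects of a category which are direct limits, computed in that category, of
direct systems of objects from the class `P` indexed by (nonempty) directed posets. -/
def directLimits {B : Type*} [Category* B] (P : ObjectProperty B) : ObjectProperty B :=
  fun N => ∃ (I : Type v) (_ : PartialOrder I) (_ : IsDirectedOrder I) (_ : Nonempty I),
    P.colimitsOfShape I N

end Contramodules

/-! The contratensor product with `M` is left adjoint to `Hom(M, -)`, which takes modules to
contramodules (`contratensorAdjunction`), and this adjunction matches `Add M` with the projective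
contramodules. On the module side the essential point is that `Hom(M, M^(X))` is the free
contramodule on `X` (`isIso_freeToHom`): a map sends a finitely generated submodule of `M` into
finitely many summands of `M^(X)`, so its components converge to zero in the finite topology. Hence
the counit is invertible at `M^(X)` and, by passing to retracts, on all of `Add M`
(`isIso_counit_of_addClosure`); for the same reason `Hom(M, D)` is projective for `D` in `Add M`.
Conversely, a projective contramodule is a retract of a free one, so its contratensor product with
`M` is a retract of some `M^(X)`.

A left adjoint preserves colimits. So a direct limit of projectives goes to a direct limit of
modules from `Add M`. If instead `N` is the direct limit of `D_i` in `Add M`, let `F` be the colimit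
of the `Hom(M, D_i)` in contramodules; its contratensor product with `M` is the colimit of the
`D_i`, by invertibility of the counits. This needs colimits of contramodules, which are built for
algebras over any monad on sets. -/

/-! ### Quotients and colimits of algebras over a monad -/

section MonadAlgebra

open Limits

/-- The algebra structure on a split quotient `q : D ⟶ Q` of an algebra `D` which is compatible with
the structure morphism of `D`. -/
def CategoryTheory.Monad.Algebra.quotient {B : Type*} [Category* B] {T : Monad B} (D : T.Algebra)
    {Q : B} (q : D.A ⟶ Q) (σ : Q ⟶ D.A) (hσ : σ ≫ q = 𝟙 Q)
    (h : T.map (q ≫ σ) ≫ D.a ≫ q = D.a ≫ q) : T.Algebra where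
  A := Q
  a := T.map σ ≫ D.a ≫ q
  unit := by
    rw [← Category.assoc, ← T.η.naturality, Category.assoc, D.unit_assoc]
    exact hσ
  assoc := by
    have hs : IsSplitEpi q := ⟨⟨σ, hσ⟩⟩
    have hq : T.map q ≫ T.map σ ≫ D.a ≫ q = D.a ≫ q := by
      rw [← T.map_comp_assoc, h]
    rw [← cancel_epi (T.map (T.map q))]
    have hμ : T.map (T.map q) ≫ T.μ.app Q ≫ T.map σ ≫ D.a ≫ q =
        T.μ.app D.A ≫ T.map q ≫ T.map σ ≫ D.a ≫ q := T.μ.naturality_assoc q _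
    rw [hμ, hq, ← T.map_comp_assoc, hq, T.map_comp_assoc, hq, D.assoc_assoc]

/-- The projection onto a quotient algebra. -/
def CategoryTheory.Monad.Algebra.toQuotient {B : Type*} [Category* B] {T : Monad B} (D : T.Algebra)
    {Q : B} (q : D.A ⟶ Q) (σ : Q ⟶ D.A) (hσ : σ ≫ q = 𝟙 Q)
    (h : T.map (q ≫ σ) ≫ D.a ≫ q = D.a ≫ q) : D ⟶ D.quotient q σ hσ h where
  f := q
  h := by
    change T.map q ≫ T.map σ ≫ D.a ≫ q = D.a ≫ q
    rw [← T.map_comp_assoc, h]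

/-- The map out of a quotient algebra induced by a compatible map. -/
def CategoryTheory.Monad.Algebra.quotientDesc {B : Type*} [Category* B] {T : Monad B}
    (D : T.Algebra) {Q : B} (q : D.A ⟶ Q) (σ : Q ⟶ D.A) (hσ : σ ≫ q = 𝟙 Q)
    (h : T.map (q ≫ σ) ≫ D.a ≫ q = D.a ≫ q) {E : T.Algebra} (g : D ⟶ E)
    (hg : q ≫ σ ≫ g.f = g.f) : D.quotient q σ hσ h ⟶ E where
  f := σ ≫ g.f
  h := by
    change T.map (σ ≫ g.f) ≫ E.a = (T.map σ ≫ D.a ≫ q) ≫ σ ≫ g.f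
    simp only [Category.assoc, hg, T.map_comp, g.h]

variable {T : Monad (Type v)} {I : Type v} [Category.{v} I] (J : I ⥤ T.Algebra)

namespace Contramodules.AlgebraColimit

/-- The free algebra on the disjoint union of a diagram. -/
def gen : T.Algebra := T.free.obj (Σ i, (J.obj i).A)

/-- The inclusion of a term of the diagram into the free algebra on the disjoint union. -/
def incl (i : I) (x : (J.obj i).A) : (gen J).A := T.η.app (Σ i, (J.obj i).A) ⟨i, x⟩

/-- The map from the free algebra on the disjoint union of a diagram to the point of a cocone. -/
def desc (c : Cocone J) : gen J ⟶ c.pt :=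
  (T.adj.homEquiv (Σ i, (J.obj i).A) _).symm (TypeCat.ofHom fun x => (c.ι.app x.1).f x.2)

theorem η_desc (c : Cocone J) (i : I) (x : (J.obj i).A) :
    (desc J c).f (incl J i x) = (c.ι.app i).f x := by
  have h := (T.adj.homEquiv _ _).apply_symm_apply
    (TypeCat.ofHom fun x : Σ i, (J.obj i).A => (c.ι.app x.1).f x.2)
  rw [T.adj.homEquiv_unit] at h
  exact ConcreteCategory.congr_hom h ⟨i, x⟩

/-- Two elements are identified if all cocones identify them. -/
def setoid : Setoid (gen J).A where
  r s t := ∀ c : Cocone J, (desc J c).f s = (desc J c).f t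
  iseqv := ⟨fun _ _ => rfl, fun h c => (h c).symm, fun h h' c => (h c).trans (h' c)⟩

/-- The underlying set of the colimit. -/
def Carrier : Type v := _root_.Quotient (setoid J)

/-- The projection onto the underlying set of the colimit. -/
def proj : (gen J).A ⟶ Carrier J := TypeCat.ofHom (_root_.Quotient.mk (setoid J))

/-- A section of the projection. -/
noncomputable def sect : Carrier J ⟶ (gen J).A := TypeCat.ofHom _root_.Quotient.out

theorem sect_proj : sect J ≫ proj J = 𝟙 _ :=
  ConcreteCategory.hom_ext _ _ fun x => _root_.Quotient.out_eq x

/-- Replacing an element by the chosen representative of its class is invisible to every cocone. -/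
theorem proj_sect_desc (c : Cocone J) : proj J ≫ sect J ≫ (desc J c).f = (desc J c).f :=
  ConcreteCategory.hom_ext _ _ fun x => _root_.Quotient.mk_out (s := setoid J) x c

/-- The identification is a congruence: each `desc J c` is an algebra homomorphism, so replacing
entries by representatives before applying the structure map changes nothing that a cocone can see.
-/
theorem compatible : T.map (proj J ≫ sect J) ≫ (gen J).a ≫ proj J =
    (gen J).a ≫ proj J := by
  refine ConcreteCategory.hom_ext _ _ fun s => _root_.Quotient.sound (s := setoid J) fun c => ?_
  have h : (T.map (proj J ≫ sect J) ≫ (gen J).a) ≫ (desc J c).f =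
      (gen J).a ≫ (desc J c).f := by
    rw [Category.assoc, ← (desc J c).h, ← T.map_comp_assoc, Category.assoc, proj_sect_desc]
  exact ConcreteCategory.congr_hom h s

/-- The colimit of a diagram of algebras. -/
noncomputable def pt : T.Algebra :=
  (gen J).quotient (proj J) (sect J) (sect_proj J) (compatible J)

/-- The projection from the free algebra onto the colimit. -/
noncomputable def toPt : gen J ⟶ pt J :=
  (gen J).toQuotient (proj J) (sect J) (sect_proj J) (compatible J)

/-- The map out of the colimit given by a cocone. -/
noncomputable def ptDesc (c : Cocone J) : pt J ⟶ c.pt :=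
  (gen J).quotientDesc (proj J) (sect J) (sect_proj J) (compatible J) (desc J c)
    (proj_sect_desc J c)

theorem toPt_ptDesc (c : Cocone J) : toPt J ≫ ptDesc J c = desc J c :=
  Monad.Algebra.Hom.ext (proj_sect_desc J c)

/-- Built into the choice of `setoid`. It allows identities in the colimit to be checked after
mapping to every cocone. -/
theorem ptDesc_injective {x y : (pt J).A} (h : ∀ c, (ptDesc J c).f x = (ptDesc J c).f y) :
    x = y := by
  refine (_root_.Quotient.out_eq (s := setoid J) x).symm.trans
    (Eq.trans ?_ (_root_.Quotient.out_eq (s := setoid J) y))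
  exact _root_.Quotient.sound h

/-- The underlying map of the canonical map to the colimit. -/
noncomputable def ιFun (i : I) : (J.obj i).A ⟶ (pt J).A :=
  TypeCat.ofHom fun x => (toPt J).f (incl J i x)

theorem ιFun_ptDesc (c : Cocone J) (i : I) : ιFun J i ≫ (ptDesc J c).f = (c.ι.app i).f := by
  refine ConcreteCategory.hom_ext _ _ fun x => ?_
  rw [← η_desc, ← toPt_ptDesc]
  rfl

/-- The canonical map to the colimit. -/
noncomputable def ι (i : I) : J.obj i ⟶ pt J where
  f := ιFun J i
  h := by
    refine ConcreteCategory.hom_ext _ _ fun s => ptDesc_injective J fun c => ?_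
    -- After composition with `ptDesc J c` both sides involve only the leg of `c` at `i`, which is
    -- an algebra homomorphism.
    have h : (T.map (ιFun J i) ≫ (pt J).a) ≫ (ptDesc J c).f =
        ((J.obj i).a ≫ ιFun J i) ≫ (ptDesc J c).f := by
      rw [Category.assoc, Category.assoc, ιFun_ptDesc, ← (ptDesc J c).h, ← T.map_comp_assoc,
        ιFun_ptDesc]
      exact (c.ι.app i).h
    exact ConcreteCategory.congr_hom h s

theorem ι_ptDesc (c : Cocone J) (i : I) : ι J i ≫ ptDesc J c = c.ι.app i :=
  Monad.Algebra.Hom.ext (ιFun_ptDesc J c i)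

/-- The projection from the free algebra is a split surjection of sets, hence epi, and a map out of
a free algebra is determined by the generators, which come from the terms of the diagram. -/
theorem pt_hom_ext {E : T.Algebra} {m m' : pt J ⟶ E} (h : ∀ i, ι J i ≫ m = ι J i ≫ m') :
    m = m' := by
  have : IsSplitEpi (toPt J).f := ⟨⟨sect J, sect_proj J⟩⟩
  have : Epi (toPt J).f := IsSplitEpi.epi _
  have : Epi (toPt J) := Monad.algebra_epi_of_epi T (toPt J)
  rw [← cancel_epi (toPt J)]
  refine (T.adj.homEquiv (Σ i, (J.obj i).A) E).injective ?_
  refine ConcreteCategory.hom_ext _ _ fun x => ?_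
  exact ConcreteCategory.congr_hom (congrArg Monad.Algebra.Hom.f (h x.1)) x.2

/-- The colimit cocone. -/
noncomputable def cocone : Cocone J where
  pt := pt J
  ι :=
    { app := ι J
      naturality := fun i j f => by
        refine Monad.Algebra.Hom.ext (ConcreteCategory.hom_ext _ _ fun s =>
          ptDesc_injective J fun c => ?_)
        have h : (J.map f ≫ ι J j) ≫ ptDesc J c = (ι J i ≫ 𝟙 (pt J)) ≫ ptDesc J c := by
          simp [ι_ptDesc]
        exact ConcreteCategory.congr_hom (congrArg Monad.Algebra.Hom.f h) s }

/-- The universal property of the colimit cocone. -/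
noncomputable def isColimit : IsColimit (cocone J) where
  desc := ptDesc J
  fac c i := ι_ptDesc J c i
  uniq c _ hm := pt_hom_ext J fun i => (hm i).trans (ι_ptDesc J c i).symm

end Contramodules.AlgebraColimit

instance CategoryTheory.Monad.Algebra.hasColimit : HasColimit J :=
  ⟨⟨⟨_, Contramodules.AlgebraColimit.isColimit J⟩⟩⟩

end MonadAlgebra

namespace Contramodules

/-! ### Homomorphisms of contramodules -/

section ContraHom

variable {S : Type v} [Ring S] [UniformSpace S] [IsUniformAddGroup S] [IsTopologicalRing S]
  [IsLinearTopology S S] [CompleteSpace S] [T2Space S] {C D : Contra S}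

theorem hom_act (f : C ⟶ D) (s : ZeroConv S C.A) : f.f (act C s) = act D (push f.f s) :=
  (ConcreteCategory.congr_hom f.h s).symm

theorem hom_add (f : C ⟶ D) (a b : C.A) : f.f (a + b) = f.f a + f.f b := by
  change f.f (act C (point a + point b)) = act D (point (f.f a) + point (f.f b))
  rw [hom_act, push_add, push_point, push_point]

/-- The homomorphism of abelian groups underlying a homomorphism of contramodules. -/
noncomputable def homAddHom (f : C ⟶ D) : C.A →+ D.A := AddMonoidHom.mk' f.f (hom_add f)

/-- A map compatible with the contraactions is a homomorphism of contramodules. -/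
def mkHom (f : C.A → D.A) (h : ∀ s, f (act C s) = act D (push f s)) : C ⟶ D where
  f := TypeCat.ofHom f
  h := ConcreteCategory.hom_ext _ _ fun s => (h s).symm

theorem contraHom_ext {f g : C ⟶ D} (h : ∀ c, f.f c = g.f c) : f = g :=
  Monad.Algebra.Hom.ext (ConcreteCategory.hom_ext _ _ h)

theorem push_push {X Y Z : Type v} (f : X → Y) (g : Y → Z) (s : ZeroConv S X) :
    push g (push f s) = push (fun x => g (f x)) s := by
  simp only [push_eq_subst, subst_subst, subst_point]

/-- Associativity of the contraaction in Kleisli form: an infinite sum of infinite sums may be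
opened. -/
theorem act_subst {X : Type v} (k : X → ZeroConv S C.A) (s : ZeroConv S X) :
    act C (subst k s) = act C (push (fun x => act C (k x)) s) := by
  have h := act_join C (push k s)
  simpa only [join, push_eq_subst, subst_subst, subst_point, id] using h

/-- The free contramodule on a set. -/
noncomputable abbrev freeContra (S : Type v) [Ring S] [UniformSpace S] [IsUniformAddGroup S]
    [IsTopologicalRing S] [IsLinearTopology S S] [CompleteSpace S] [T2Space S] (X : Type v) :
    Contra S :=
  (contraMonad S).free.obj X

theorem act_push_join {X : Type v} (g : X → C.A) (s : ZeroConv S (ZeroConv S X)) :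
    act C (push g (join s)) = act C (push (fun t => act C (push g t)) s) := by
  rw [join, push_eq_subst, subst_subst, act_subst]
  simp only [push_eq_subst g, id]

/-- The homomorphism from a free contramodule extending a map. -/
noncomputable def freeDesc {X : Type v} (g : X → C.A) : freeContra S X ⟶ C :=
  mkHom (C := freeContra S X) (fun s : ZeroConv S X => act C (push g s))
    fun s => act_push_join g s

theorem freeDesc_apply {X : Type v} (g : X → C.A) (s : ZeroConv S X) :
    (freeDesc g).f s = act C (push g s) := rfl

theorem freeDesc_point {X : Type v} (g : X → C.A) (x : X) :
    (freeDesc g).f (point x : ZeroConv S X) = g x := by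
  rw [freeDesc_apply, push_point, act_point]

/-- Every element of a free contramodule is the infinite sum of point measures with its own
coefficients, and homomorphisms respect infinite sums. -/
theorem freeContra_hom_ext {X : Type v} {f g : freeContra S X ⟶ C}
    (h : ∀ x, f.f (point x : ZeroConv S X) = g.f (point x : ZeroConv S X)) : f = g := by
  refine contraHom_ext fun s => ?_
  have key : ∀ k : freeContra S X ⟶ C,
      k.f s = act C (push (fun x => k.f (point x : ZeroConv S X)) s) := by
    intro k
    have hs : s = act (freeContra S X) (push point s) := (join_push_point s).symm
    refine (congrArg (fun t => k.f t) hs).trans ((hom_act k _).trans (congrArg (act C) ?_))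
    exact push_push point k.f s
  rw [key f, key g]
  simp only [h]

end ContraHom

/-! ### The contramodule of homomorphisms and the adjunction -/

section HomContra

variable {S : Type v} [Ring S] [UniformSpace S] [IsUniformAddGroup S] [IsTopologicalRing S]
  [IsLinearTopology S S] [CompleteSpace S]
  {A : Type u} [Ring A] {M : Type v} [AddCommGroup M] [Module S M] [IsDiscreteModule S M]

/-- The annihilator of `b` is open, so `s ↦ s • b` is locally constant and a sufficiently large
finite partial sum already acts on `b` as the limit does. -/
theorem tsum_smul_of_finite [T2Space S] {X : Type v} {f : X → S}
    (hf : ∀ I : Ideal S, IsOpen (I : Set S) → {x | f x ∉ I}.Finite) (b : M) :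
    (∑' x, f x) • b = ∑ᶠ x, f x • b := by
  classical
  have hs : Set.Finite {x | f x • b ≠ 0} :=
    finite_support (⟨f, hf⟩ : ZeroConv S X) b
  have hJ : {s : S | s • b = (∑' x, f x) • b} ∈ 𝓝 (∑' x, f x) := by
    have h0 : {s : S | s • b = 0} ∈ 𝓝 ((∑' x, f x) - ∑' x, f x) := by
      rw [sub_self]
      exact (IsDiscreteModule.isOpen_annihilator b).mem_nhds (zero_smul S b)
    have hc : Continuous fun s : S => s - ∑' x, f x := continuous_id.sub continuous_const
    filter_upwards [hc.continuousAt h0] with s h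
    have h' : (s - ∑' x, f x) • b = 0 := h
    rwa [sub_smul, sub_eq_zero] at h'
  have hsum : Filter.Tendsto (fun F : Finset X => ∑ x ∈ F, f x) Filter.atTop (𝓝 (∑' x, f x)) :=
    (summable_of_finite hf).hasSum
  obtain ⟨F, h1, h2⟩ := ((hsum.eventually hJ).and (Filter.eventually_ge_atTop hs.toFinset)).exists
  have h1' : (∑ x ∈ F, f x) • b = (∑' x, f x) • b := h1
  rw [← h1', Finset.sum_smul, finsum_eq_sum_of_support_subset]
  intro x hx
  exact h2 (by simpa using hx)

variable [Module A M] [SMulCommClass S A M]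
  {N : Type v} [AddCommGroup N] [Module A N]

theorem finite_support_apply {X : Type v} (g : X → M →ₗ[A] N) (s : ZeroConv S X) (b : M) :
    (Function.support fun x => g x (s.1 x • b)).Finite :=
  (finite_support s b).subset fun x hx h => hx (by simp [h])

/-- The linear combination `∑ g_x s_x` of linear maps `g_x : M → N`, with zero-convergent
coefficients. -/
noncomputable def linComb {X : Type v} (g : X → M →ₗ[A] N) (s : ZeroConv S X) : M →ₗ[A] N where
  toFun b := ∑ᶠ x, g x (s.1 x • b)
  map_add' b b' := by
    rw [← finsum_add_distrib (finite_support_apply g s b) (finite_support_apply g s b')]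
    simp only [smul_add, map_add]
  map_smul' a b := by
    rw [RingHom.id_apply, smul_finsum' _ (finite_support_apply g s b)]
    simp only [smul_comm _ a, map_smul]

theorem linComb_apply {X : Type v} (g : X → M →ₗ[A] N) (s : ZeroConv S X) (b : M) :
    linComb g s b = ∑ᶠ x, g x (s.1 x • b) := rfl

theorem linComb_point {X : Type v} (g : X → M →ₗ[A] N) (x : X) :
    linComb g (point x : ZeroConv S X) = g x := by
  classical
  ext b
  rw [linComb_apply, finsum_eq_single _ x]
  · simp [point_apply]
  · intro y hy
    simp [point_apply, hy]

/-- Associativity for `Hom(M, N)`. On a fixed `b` only finitely many pairs `(x, y)` contribute, so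
the double sum can be taken in either order. -/
theorem linComb_subst [T2Space S] {X Y : Type v} (g : Y → M →ₗ[A] N) (k : X → ZeroConv S Y)
    (s : ZeroConv S X) : linComb g (subst k s) = linComb (fun x => linComb g (k x)) s := by
  ext b
  simp only [linComb_apply]
  have hfin : {p : X × Y | ((k p.1).1 p.2 * s.1 p.1) • b ≠ 0}.Finite :=
    finite_pairs k s (LinearMap.ker (LinearMap.toSpanSingleton S M b))
      (IsDiscreteModule.isOpen_annihilator b)
  have hfin' : (Function.support fun p : X × Y =>
      g p.2 ((k p.1).1 p.2 • s.1 p.1 • b)).Finite :=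
    hfin.subset fun p hp h => hp (by rw [mul_smul] at h; simp [h])
  have h1 : ∀ y, g y ((subst k s).1 y • b) = ∑ᶠ x, g y ((k x).1 y • s.1 x • b) := by
    intro y
    have hI : ∀ I : Ideal S, IsOpen (I : Set S) → {x | (k x).1 y * s.1 x ∉ I}.Finite :=
      fun I hI => (s.2 I hI).subset fun _ hx h => hx (I.mul_mem_left _ h)
    change g y ((∑' x, (k x).1 y * s.1 x) • b) = _
    rw [tsum_smul_of_finite hI, map_finsum (g y)]
    · simp only [mul_smul]
    · exact finite_support (⟨_, hI⟩ : ZeroConv S X) b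
  simp only [h1]
  rw [← finsum_curry (fun p : X × Y => g p.2 ((k p.1).1 p.2 • s.1 p.1 • b)) hfin']
  rw [← finsum_comp_equiv (Equiv.prodComm Y X)]
  exact (finsum_curry _ (hfin'.preimage (Equiv.prodComm Y X).injective.injOn)).symm

theorem linComb_push [T2Space S] {X Y : Type v} (g : Y → M →ₗ[A] N) (f : X → Y)
    (s : ZeroConv S X) : linComb g (push f s) = linComb (fun x => g (f x)) s := by
  rw [push_eq_subst, linComb_subst]
  simp only [linComb_point]

theorem comp_linComb {N' : Type v} [AddCommGroup N'] [Module A N'] (φ : N →ₗ[A] N') {X : Type v}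
    (g : X → M →ₗ[A] N) (s : ZeroConv S X) :
    φ ∘ₗ linComb g s = linComb (fun x => φ ∘ₗ g x) s := by
  ext b
  exact map_finsum φ (finite_support_apply g s b)

variable [T2Space S]

variable (S A M) in
/-- The contramodule of linear maps `M → N`. -/
noncomputable def homContra (N : ModuleCat.{v} A) : Contra S where
  A := M →ₗ[A] N
  a := TypeCat.ofHom (linComb (S := S) id)
  unit := ConcreteCategory.hom_ext _ _ fun f => linComb_point (S := S) id f
  assoc := ConcreteCategory.hom_ext _ _ fun s => by
    exact (linComb_subst (S := S) (M := M) (A := A) (N := N) id id s).trans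
      (linComb_push (S := S) (M := M) (A := A) (N := N) id (linComb id) s).symm

theorem act_homContra_push {N : ModuleCat.{v} A} {X : Type v} (g : X → M →ₗ[A] N)
    (s : ZeroConv S X) :
    act (homContra S A M N) (push g s) = linComb (S := S) g s :=
  linComb_push id g s

variable (S A M) in
/-- The functor `Hom_A(M, -)` from modules to contramodules. -/
noncomputable def homFunctor : ModuleCat.{v} A ⥤ Contra S where
  obj N := homContra S A M N
  map {N N'} φ := mkHom (C := homContra S A M N) (D := homContra S A M N')
    (fun f : M →ₗ[A] N => φ.hom ∘ₗ f) fun s =>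
      (comp_linComb φ.hom id s).trans
        (act_homContra_push (N := N') (fun f : M →ₗ[A] N => φ.hom ∘ₗ f) s).symm
  map_id _ := rfl
  map_comp _ _ := rfl

/-- The linear map underlying an element of the contramodule of linear maps. -/
def toLin {N : ModuleCat.{v} A} (f : (homContra S A M N).A) : M →ₗ[A] N := f

/-- The addition on the left comes from the contraaction; it has to be compared with pointwise
addition before maps out of a tensor product over `ℤ` can be defined. -/
theorem homContra_add_apply {N : ModuleCat.{v} A} (f g : (homContra S A M N).A) (b : M) :
    toLin (f + g) b = toLin f b + toLin g b := by
  have key : ∀ s t : ZeroConv S (M →ₗ[A] N),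
      linComb (S := S) id (s + t) b = linComb id s b + linComb id t b := by
    intro s t
    simp only [linComb_apply]
    rw [← finsum_add_distrib (finite_support_apply id s b) (finite_support_apply id t b)]
    refine finsum_congr fun x => ?_
    rw [← map_add, ← add_smul]
    rfl
  refine (key (point (toLin f)) (point (toLin g))).trans ?_
  rw [linComb_point, linComb_point]
  rfl

variable (C : Contra S)

theorem toLin_hom_act {N : ModuleCat.{v} A} (g : C ⟶ homContra S A M N) (s : ZeroConv S C.A) :
    toLin (g.f (act C s)) = linComb (fun c => toLin (g.f c)) s :=
  (congrArg toLin (hom_act g s)).trans (act_homContra_push (fun c => toLin (g.f c)) s)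

variable (A M) in
/-- The class of `b ⊗ c` in the contratensor product. -/
noncomputable def ctmul (c : C.A) : M →ₗ[A] Contratensor A C M :=
  Submodule.mkQ _ ∘ₗ (AlgebraTensorModule.mk ℤ A M C.A).flip c

theorem ctmul_act (s : ZeroConv S C.A) : ctmul A M C (act C s) = linComb (ctmul A M C) s := by
  ext b
  have h : (Submodule.mkQ (LinearMap.range (tMap A C M - actMap A C M))) (tMap A C M (b ⊗ₜ s)) =
      (Submodule.mkQ (LinearMap.range (tMap A C M - actMap A C M))) (actMap A C M (b ⊗ₜ s)) := by
    rw [← sub_eq_zero, ← map_sub, Submodule.mkQ_apply, Submodule.Quotient.mk_eq_zero]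
    exact ⟨b ⊗ₜ s, rfl⟩
  refine h.symm.trans ?_
  rw [tMap_tmul, map_finsum _ (finite_support_tmul C M s b)]
  rfl

/-- The linear map from the contratensor product given by a homomorphism `C ⟶ Hom_A(M, N)`. -/
noncomputable def contratensorLift {N : ModuleCat.{v} A} (g : C ⟶ homContra S A M N) :
    Contratensor A C M →ₗ[A] N :=
  Submodule.liftQ _
    (AlgebraTensorModule.lift
      { toFun := fun b => AddMonoidHom.toIntLinearMap
          (AddMonoidHom.mk' (fun c : C.A => toLin (g.f c) b) fun c c' => by
            rw [hom_add]
            exact homContra_add_apply _ _ b)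
        map_add' := fun b b' => by
          ext c
          exact map_add (toLin (g.f c)) b b'
        map_smul' := fun a b => by
          ext c
          exact map_smul (toLin (g.f c)) a b }) <| by
    -- Killing the difference of the two maps amounts to compatibility of `g` with the
    -- contraactions.
    rw [LinearMap.range_le_ker_iff, LinearMap.comp_sub, sub_eq_zero]
    ext b s
    change AlgebraTensorModule.lift _ (tMap A C M (b ⊗ₜ s)) =
      toLin (g.f (act C s)) b
    rw [tMap_tmul, map_finsum _ (finite_support_tmul C M s b), toLin_hom_act]
    rfl

theorem contratensor_hom_ext {N : Type*} [AddCommGroup N] [Module A N]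
    {f g : Contratensor A C M →ₗ[A] N}
    (h : ∀ c b, f (ctmul A M C c b) = g (ctmul A M C c b)) : f = g := by
  refine Submodule.linearMap_qext _ (AlgebraTensorModule.ext fun b c => h c b)

variable (A M) in
/-- The adjunction between contratensor product and `Hom`, on morphisms. -/
noncomputable def contratensorHomEquiv (C : Contra S) (N : ModuleCat.{v} A) :
    (ModuleCat.of A (Contratensor A C M) ⟶ N) ≃ (C ⟶ (homFunctor S A M).obj N) where
  toFun φ := mkHom (D := homContra S A M N) (fun c => φ.hom ∘ₗ ctmul A M C c) fun s => by
    rw [ctmul_act, comp_linComb, act_homContra_push]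
  invFun g := ModuleCat.ofHom (contratensorLift C g)
  left_inv φ := ModuleCat.hom_ext (contratensor_hom_ext C fun _ _ => rfl)
  right_inv g := contraHom_ext fun c => rfl

variable (S A M) in
/-- The contratensor product with `M` as a functor. -/
noncomputable def contratensorFunctor : Contra S ⥤ ModuleCat.{v} A :=
  Adjunction.leftAdjointOfEquiv (G := homFunctor S A M) (contratensorHomEquiv A M)
    fun _ _ _ _ _ => rfl

variable (S A M) in
/-- The contratensor product with `M` is left adjoint to `Hom_A(M, -)`. -/
noncomputable def contratensorAdjunction : contratensorFunctor S A M ⊣ homFunctor S A M :=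
  Adjunction.adjunctionOfEquivLeft (G := homFunctor S A M) (contratensorHomEquiv A M)
    fun _ _ _ _ _ => rfl

end HomContra

/-! ### Projective contramodules -/

section Projective

variable {S : Type v} [Ring S] [UniformSpace S] [IsUniformAddGroup S] [IsTopologicalRing S]
  [IsLinearTopology S S] [CompleteSpace S] [T2Space S] {C D : Contra S}

theorem subst_sub {X Y : Type v} (k l : X → ZeroConv S Y) (s : ZeroConv S X) :
    subst (fun x => k x - l x) s = subst k s - subst l s := by
  refine Subtype.ext (funext fun y => ?_)
  change ∑' x, ((k x).1 y - (l x).1 y) * s.1 x =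
    ∑' x, (k x).1 y * s.1 x - ∑' x, (l x).1 y * s.1 x
  simp only [sub_mul]
  exact (summable_fst k s y).tsum_sub (summable_fst l s y)

theorem act_sub (s t : ZeroConv S C.A) : act C (s - t) = act C s - act C t :=
  map_sub (actHom C) s t

/-- Each entry `f c - g c` is itself a contraaction value, so opening parentheses reduces this to
additivity of substitution. -/
theorem act_push_sub (f g : C.A → C.A) (s : ZeroConv S C.A) :
    act C (push (fun c => f c - g c) s) = act C (push f s) - act C (push g s) := by
  have h : ∀ c, f c - g c = act C (point (f c) - point (g c)) := fun c => by
    rw [act_sub, act_point, act_point]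
  simp only [h]
  rw [← act_subst, subst_sub, act_sub, push_eq_subst, push_eq_subst]

theorem act_mem_range (e : C ⟶ D) {X : Type v} (g : X → D.A)
    (hg : ∀ x, g x ∈ (homAddHom e).range) (s : ZeroConv S X) :
    act D (push g s) ∈ (homAddHom e).range := by
  choose k hk using hg
  refine ⟨act C (push k s), ?_⟩
  refine (hom_act e _).trans ?_
  rw [push_push]
  exact congrArg (fun g => act D (push g s)) (funext hk)

/-- Changing the entries of an infinite sum by elements of the image of `e` changes the sum by an
element of that image. Thus the cokernel of `e` as a group carries a contramodule structure. -/
theorem mk_act_push_sect {K : AddSubgroup D.A} (e : C ⟶ D) (hK : K = (homAddHom e).range)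
    (s : ZeroConv S D.A) :
    (QuotientAddGroup.mk (act D (push (fun d => (QuotientAddGroup.mk d : D.A ⧸ K).out) s)) :
      D.A ⧸ K) = QuotientAddGroup.mk (act D s) := by
  have hs : act D s = act D (push (fun d => d) s) := by
    rw [push_eq_subst, subst_self]
  rw [hs, ← sub_eq_zero, ← QuotientAddGroup.mk_sub, ← act_push_sub, QuotientAddGroup.eq_zero_iff,
    hK]
  refine act_mem_range e _ (fun d => ?_) s
  rw [← hK, ← QuotientAddGroup.eq_zero_iff, QuotientAddGroup.mk_sub, sub_eq_zero]
  exact QuotientAddGroup.out_eq' _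

/-- The projection to the cokernel and the zero map agree after `e`, so they coincide and the
cokernel vanishes. -/
theorem surjective_of_epi (e : C ⟶ D) [Epi e] : Function.Surjective e.f := by
  let K : AddSubgroup D.A := (homAddHom e).range
  let q : D.A ⟶ (D.A ⧸ K) := TypeCat.ofHom QuotientAddGroup.mk
  let σ : (D.A ⧸ K) ⟶ D.A := TypeCat.ofHom Quotient.out
  have hσ : σ ≫ q = 𝟙 _ := ConcreteCategory.hom_ext _ _ fun x => QuotientAddGroup.out_eq' x
  have hc : (contraMonad S).map (q ≫ σ) ≫ D.a ≫ q = D.a ≫ q :=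
    ConcreteCategory.hom_ext _ _ fun s => mk_act_push_sect (K := K) e rfl s
  let Q : Contra S := D.quotient q σ hσ hc
  let p : D ⟶ Q := D.toQuotient q σ hσ hc
  let z : D ⟶ Q := mkHom (fun _ => p.f 0) fun s => by
    have h0 : act D (push (fun _ => (0 : D.A)) s) = 0 := by
      have h := act_push_sub (fun d => d) (fun d => d) s
      simpa only [sub_self] using h
    have h1 := hom_act p (push (fun _ => (0 : D.A)) s)
    rw [h0, push_push] at h1
    exact h1
  have hpz : p = z := by
    rw [← cancel_epi e]
    refine contraHom_ext fun c => ?_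
    change (QuotientAddGroup.mk (e.f c) : D.A ⧸ K) = QuotientAddGroup.mk 0
    rw [QuotientAddGroup.mk_zero, QuotientAddGroup.eq_zero_iff]
    exact ⟨c, rfl⟩
  intro d
  have h : (QuotientAddGroup.mk d : D.A ⧸ K) = QuotientAddGroup.mk 0 :=
    ConcreteCategory.congr_hom (congrArg Monad.Algebra.Hom.f hpz) d
  rw [QuotientAddGroup.mk_zero, QuotientAddGroup.eq_zero_iff] at h
  exact h

instance projective_freeContra (X : Type v) : Projective (freeContra S X) where
  factors f e he := by
    choose g hg using surjective_of_epi e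
    refine ⟨freeDesc fun x => g (f.f (point x : ZeroConv S X)), freeContra_hom_ext fun x => ?_⟩
    refine (congrArg e.f (freeDesc_point _ x)).trans (hg _)

/-- The free contramodule on the underlying set of `P` surjects onto `P`, and projectivity splits
this surjection. -/
theorem exists_retract_freeContra (P : Contra S) [Projective P] :
    ∃ X : Type v, Nonempty (Retract P (freeContra S X)) := by
  let r : freeContra S P.A ⟶ P := freeDesc fun x => x
  have hr : Function.Surjective r.f := fun x => ⟨_, freeDesc_point (fun x => x) x⟩
  have : Epi r.f := (epi_iff_surjective _).2 hr
  have : Epi r := Monad.algebra_epi_of_epi _ r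
  exact ⟨P.A, ⟨⟨Projective.factorThru (𝟙 P) r, r, Projective.factorThru_comp _ _⟩⟩⟩

end Projective

/-! ### Direct summands of copowers of a module -/

section AddClosure

variable {A : Type u} [Ring A] {M : Type v} [AddCommGroup M] [Module A M]

theorem addClosure_iff_retract (D : ModuleCat.{v} A) :
    AddClosure A M D ↔ ∃ X : Type v, Nonempty (Retract D (ModuleCat.of A (X →₀ M))) := by
  constructor
  · rintro ⟨X, E, ⟨e⟩⟩
    exact ⟨X, ⟨⟨ModuleCat.ofHom (e.toLinearMap ∘ₗ LinearMap.inl A D E),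
      ModuleCat.ofHom (LinearMap.fst A D E ∘ₗ e.symm.toLinearMap), by ext; simp⟩⟩⟩
  · rintro ⟨X, ⟨ρ⟩⟩
    let i : D →ₗ[A] X →₀ M := ρ.i.hom
    let r : (X →₀ M) →ₗ[A] D := ρ.r.hom
    have h : ∀ d, r (i d) = d := fun d => ConcreteCategory.congr_hom ρ.retract d
    have hr : ∀ x, (LinearMap.id - i ∘ₗ r : (X →₀ M) →ₗ[A] X →₀ M) x ∈ LinearMap.ker r :=
      fun x => by simp [h]
    -- The complement of a retract is the kernel of the retraction, with projection `id - i ∘ r`.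
    refine ⟨X, ModuleCat.of A (LinearMap.ker r), ⟨LinearEquiv.ofLinearMap
      (i.coprod (LinearMap.ker r).subtype)
      (r.prod ((LinearMap.id - i ∘ₗ r).codRestrict _ hr)) ?_ ?_⟩⟩
    · refine LinearMap.ext fun x => ?_
      simp
    · refine LinearMap.ext ?_
      rintro ⟨d, k, hk⟩
      have hk' : r k = 0 := hk
      refine Prod.ext ?_ (Subtype.ext ?_)
      · simp [h, hk']
      · simp [h, hk']

theorem exists_endAnnihilator_le {I : Ideal (Module.End A M)}
    (hI : IsOpen (I : Set (Module.End A M))) :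
    ∃ N : Submodule A M, N.FG ∧ ∀ f ∈ endAnnihilator N, f ∈ I := by
  obtain ⟨N, -, hN⟩ := hasBasis_nhds_zero.mem_iff.1 (hI.mem_nhds I.zero_mem)
  exact ⟨N.1, N.2, fun f hf => hN hf⟩

/-- The family of components of a linear map to a copower of `M` converges to zero. -/
noncomputable def components {X : Type v} (f : M →ₗ[A] X →₀ M) : ZeroConv (Module.End A M) X :=
  ⟨fun x => Finsupp.lapply x ∘ₗ f, fun I hI => by
    obtain ⟨N, ⟨F, rfl⟩, h⟩ := exists_endAnnihilator_le hI
    refine (F.finite_toSet.biUnion fun m _ => (f m).support.finite_toSet).subset fun x hx => ?_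
    by_contra hx'
    simp only [Set.mem_iUnion, not_exists, Finset.mem_coe, Finsupp.mem_support_iff,
      not_not] at hx'
    refine hx (h _ fun m hm => ?_)
    have : Submodule.span A (F : Set M) ≤ LinearMap.ker (Finsupp.lapply x ∘ₗ f) :=
      Submodule.span_le.2 fun m hm => hx' m hm
    exact this hm⟩

/-- Coordinates recover coefficients; this yields both injectivity and surjectivity of `freeToHom`.
-/
theorem linComb_lsingle_apply {X : Type v} (s : ZeroConv (Module.End A M) X) (b : M) (x : X) :
    linComb (fun x => (Finsupp.lsingle x : M →ₗ[A] X →₀ M)) s b x = s.1 x b := by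
  classical
  rw [linComb_apply]
  refine (map_finsum (Finsupp.applyAddHom x)
    (finite_support_apply (fun x => (Finsupp.lsingle x : M →ₗ[A] X →₀ M)) s b)).trans ?_
  rw [finsum_eq_single _ x]
  · simp
  · intro y hy
    simp [hy]

variable (A M) in
/-- The homomorphism from the free contramodule on `X` to `Hom(M, M^(X))`. -/
noncomputable def freeToHom (X : Type v) :
    freeContra (Module.End A M) X ⟶
      (homFunctor (Module.End A M) A M).obj (ModuleCat.of A (X →₀ M)) :=
  freeDesc (C := homContra (Module.End A M) A M (ModuleCat.of A (X →₀ M))) fun x =>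
    (Finsupp.lsingle x : M →ₗ[A] X →₀ M)

theorem freeToHom_apply {X : Type v} (s : ZeroConv (Module.End A M) X) :
    (freeToHom A M X).f s = linComb (fun x => (Finsupp.lsingle x : M →ₗ[A] X →₀ M)) s :=
  (freeDesc_apply _ s).trans (act_homContra_push (N := ModuleCat.of A (X →₀ M)) _ s)

instance isIso_freeToHom (X : Type v) : IsIso (freeToHom A M X) := by
  have : IsIso (freeToHom A M X).f := by
    rw [isIso_iff_bijective]
    constructor
    · intro (s : ZeroConv _ X) (t : ZeroConv _ X) h
      rw [freeToHom_apply, freeToHom_apply] at h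
      refine Subtype.ext (funext fun x => LinearMap.ext fun b => ?_)
      rw [← linComb_lsingle_apply, ← linComb_lsingle_apply]
      exact congrArg (fun f : M →ₗ[A] X →₀ M => f b x) h
    · intro (f : M →ₗ[A] X →₀ M)
      refine ⟨components f, ?_⟩
      refine (freeToHom_apply _).trans ?_
      refine LinearMap.ext fun b => Finsupp.ext fun x => ?_
      exact linComb_lsingle_apply _ b x
  exact Monad.algebra_iso_of_iso _ _

/-- `Hom(M, M^(X))` is free on the coordinate inclusions, so on both sides a morphism is an
arbitrary family of maps `M → N` indexed by `X`. -/
theorem homFunctor_map_bijective (X : Type v) (N : ModuleCat.{v} A) :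
    Function.Bijective fun f : ModuleCat.of A (X →₀ M) ⟶ N =>
      (homFunctor (Module.End A M) A M).map f := by
  constructor
  · intro f g h
    ext x b
    have := ConcreteCategory.congr_hom (congrArg Monad.Algebra.Hom.f h)
      (Finsupp.lsingle x : M →ₗ[A] X →₀ M)
    exact congrArg (fun k : M →ₗ[A] N => k b) this
  · intro k
    refine ⟨ModuleCat.ofHom (Finsupp.lsum ℕ fun x =>
      toLin (N := N) (k.f (Finsupp.lsingle x : M →ₗ[A] X →₀ M))), ?_⟩
    rw [← cancel_epi (freeToHom A M X)]
    refine freeContra_hom_ext fun x => ?_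
    have hx : (freeToHom A M X).f (point x : ZeroConv (Module.End A M) X) =
        (Finsupp.lsingle x : M →ₗ[A] X →₀ M) := freeDesc_point _ x
    refine (congrArg (fun c => ((homFunctor (Module.End A M) A M).map _).f c) hx).trans
      (Eq.trans ?_ (congrArg (fun c => k.f c) hx).symm)
    refine LinearMap.ext fun b => ?_
    change Finsupp.lsum ℕ _ (Finsupp.single x b) = _
    rw [Finsupp.lsum_single]
    rfl

instance isIso_counit_finsupp (X : Type v) :
    IsIso ((contratensorAdjunction (Module.End A M) A M).counit.app
      (ModuleCat.of A (X →₀ M))) := by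
  -- Under the adjunction, precomposition with the counit becomes the action of `Hom(M, -)` on
  -- morphisms.
  refine isIso_of_coyoneda_map_bijective _ fun N => ?_
  have h := ((contratensorAdjunction (Module.End A M) A M).homEquiv _ N).symm.bijective.comp
    (homFunctor_map_bijective (M := M) X N)
  refine (congrArg Function.Bijective (funext fun f => ?_)).mp h
  rw [Function.comp_apply, Adjunction.homEquiv_counit]
  exact (contratensorAdjunction (Module.End A M) A M).counit.naturality f

theorem isIso_counit_of_addClosure {D : ModuleCat.{v} A} (hD : AddClosure A M D) :
    IsIso ((contratensorAdjunction (Module.End A M) A M).counit.app D) := by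
  obtain ⟨X, ⟨ρ⟩⟩ := (addClosure_iff_retract D).1 hD
  exact (MorphismProperty.isomorphisms _).of_retract
    (NatTrans.retractArrowApp (contratensorAdjunction (Module.End A M) A M).counit ρ)
    (isIso_counit_finsupp X)

theorem projective_homFunctor_obj {D : ModuleCat.{v} A} (hD : AddClosure A M D) :
    Projective ((homFunctor (Module.End A M) A M).obj D) := by
  obtain ⟨X, ⟨ρ⟩⟩ := (addClosure_iff_retract D).1 hD
  have : Projective ((homFunctor (Module.End A M) A M).obj (ModuleCat.of A (X →₀ M))) :=
    Projective.of_iso (asIso (freeToHom A M X)) inferInstance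
  exact (ρ.map (homFunctor (Module.End A M) A M)).projective

/-- The free contramodule on `X` is `Hom(M, M^(X))`, and the counit identifies its contratensor
product with `M^(X)`. -/
theorem addClosure_contratensorFunctor_obj (P : Contra (Module.End A M)) [Projective P] :
    AddClosure A M ((contratensorFunctor (Module.End A M) A M).obj P) := by
  obtain ⟨X, ⟨ρ⟩⟩ := exists_retract_freeContra P
  rw [addClosure_iff_retract]
  exact ⟨X, ⟨(ρ.map (contratensorFunctor (Module.End A M) A M)).trans (Retract.ofIso
    ((contratensorFunctor (Module.End A M) A M).mapIso (asIso (freeToHom A M X)) ≪≫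
      @asIso _ _ _ _ _ (isIso_counit_finsupp (M := M) X)))⟩⟩

theorem directLimits_addClosure_iff (N : ModuleCat.{v} A) :
    directLimits.{v} (AddClosure A M) N ↔
      ∃ F : Contra (Module.End A M), directLimits.{v} (isProjective (Contra (Module.End A M))) F ∧
        Nonempty (N ≅ ModuleCat.of A (Contratensor A F M)) := by
  have hL : Limits.PreservesColimitsOfSize.{v, v} (contratensorFunctor (Module.End A M) A M) :=
    (contratensorAdjunction (Module.End A M) A M).leftAdjoint_preservesColimits
  constructor
  · rintro ⟨I, _, hdir, hne, ⟨p⟩⟩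
    let J := p.diag ⋙ homFunctor (Module.End A M) A M
    refine ⟨Limits.colimit J, ⟨I, _, hdir, hne,
      ⟨{ Limits.ColimitPresentation.colimit J with
          prop_diag_obj := fun i => projective_homFunctor_obj (p.prop_diag_obj i) }⟩⟩, ⟨?_⟩⟩
    have hiso : ∀ i, IsIso ((contratensorAdjunction (Module.End A M) A M).counit.app
        (p.diag.obj i)) := fun i => isIso_counit_of_addClosure (p.prop_diag_obj i)
    -- The counits identify the image of the diagram of Hom contramodules with the original diagram
    -- in `Add M`.
    let α : J ⋙ contratensorFunctor (Module.End A M) A M ≅ p.diag :=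
      NatIso.ofComponents (fun i => @asIso _ _ _ _ _ (hiso i)) fun f =>
        (contratensorAdjunction (Module.End A M) A M).counit.naturality (p.diag.map f)
    exact p.isColimit.coconePointsIsoOfNatIso
      (Limits.isColimitOfPreserves (contratensorFunctor (Module.End A M) A M)
        (Limits.colimit.isColimit J)) α.symm
  · rintro ⟨F, ⟨I, _, hdir, hne, ⟨p⟩⟩, ⟨e⟩⟩
    refine ⟨I, _, hdir, hne, ?_⟩
    refine ObjectProperty.prop_of_iso _ e.symm
      (X := (contratensorFunctor (Module.End A M) A M).obj F) ?_
    exact ⟨{ p.toColimitPresentation.map (contratensorFunctor (Module.End A M) A M) with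
      prop_diag_obj := fun i =>
        have := p.prop_diag_obj i
        addClosure_contratensorFunctor_obj (p.diag.obj i) }⟩

end AddClosure

end Contramodules

/-- Right `R`-modules are treated as left modules over the opposite ring. -/
theorem mainTheorem2 {R : Type u} [Ring R] {M : Type v} [AddCommGroup M] [Module Rᵐᵒᵖ M]
    (N : ModuleCat.{v} Rᵐᵒᵖ) :
    Contramodules.directLimits.{v} (Contramodules.AddClosure Rᵐᵒᵖ M) N ↔
      ∃ F : Contramodules.Contra (Module.End Rᵐᵒᵖ M),
        Contramodules.directLimits.{v}
          (isProjective (Contramodules.Contra (Module.End Rᵐᵒᵖ M))) F ∧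
          Nonempty (N ≅ ModuleCat.of Rᵐᵒᵖ (Contramodules.Contratensor Rᵐᵒᵖ F M)) :=
  Contramodules.directLimits_addClosure_iff N
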